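/- Let $R$ be a commutative ring with unity and let $C$ be a semidualizing $R$-module, i.e. $C$ admits a resolution by finitely generated projective $R$-modules, the homothety map $R\to\operatorname{Hom}_R(C,C)$ is an isomorphism, and $\operatorname{Ext}^i_R(C,C)=0$ for all $i\ge 1$. An $R$-module $M$ is called $G_C$-projective if there is an exact sequence $$\mathbb X=\cdots\to P_1\to P_0\to C\otimes_R P_{-1}\to C\otimes_R P_{-2}\to\cdots$$ with all $P_i$ projective such that $M\cong\operatorname{im}(P_0\to C\otimes_R P_{-1})$ and $\operatorname{Hom}_R(\mathbb X,C\otimes_R P)$ is exact for every projective $R$-module $P$. It is called $G_C$-flat if there is an exact sequence $$\mathbb Y=\cdots\to F_1\to F_0\to C\otimes_R F_{-1}\to C\otimes_R F_{-2}\to\cdots$$ with all $F_i$ flat such that $M\cong\operatorname{im}(F_0\to C\otimes_R F_{-1})$ and $\operatorname{Hom}_R(C,I)\otimes_R\mathbb Y$ is exact for every injective $R$-module $I$. The ring $R$ is called $C$-Gorenstein hereditary if every submodule of a projective $R$-module is $G_C$-projective, and $C$-Gorenstein semihereditary if $R$ is coherent (every finitely generated ideal is finitely presented) and every submodule of a flat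 $R$-module is $G_C$-flat. **Theorem.** If $R$ is $C$-Gorenstein hereditary, then $R$ is $C$-Gorenstein semihereditary; that is, $R$ is coherent and every submodule of a flat $R$-module is $G_C$-flat. -/

import Mathlib

open scoped TensorProduct

universe u

/-- `R` is coherent: every finitely generated ideal is finitely presented. -/
def IsCoherentRing (R : Type u) [CommRing R] : Prop :=
  ∀ I : Ideal R, I.FG → Module.FinitePresentation R I

/-- `C` admits a degreewise finite projective resolution: an exact sequence
`⋯ → P 1 → P 0 → C → 0` with every `P n` finitely generated projective. -/
def HasDegreewiseFiniteProjectiveResolution (R : Type u) [CommRing R]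
    (C : Type u) [AddCommGroup C] [Module R C] : Prop :=
  ∃ (P : ℕ → ModuleCat.{u} R) (d : ∀ n, P (n + 1) →ₗ[R] P n) (ε : P 0 →ₗ[R] C),
    (∀ n, Module.Projective R (P n) ∧ Module.Finite R (P n)) ∧
    Function.Surjective ε ∧ Function.Exact (d 0) ε ∧
    ∀ n, Function.Exact (d (n + 1)) (d n)

/-- Semidualizing modules over a commutative ring. The map `LinearMap.lsmul R C` is the
homothety map `R → Hom_R(C, C)`. -/
structure IsSemidualizing (R : Type u) [CommRing R]
    (C : Type u) [AddCommGroup C] [Module R C] : Prop where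
  resolution : HasDegreewiseFiniteProjectiveResolution R C
  homothety : Function.Bijective (LinearMap.lsmul R C)
  ext_eq_zero : ∀ i : ℕ, 1 ≤ i →
    Subsingleton (CategoryTheory.Abelian.Ext (ModuleCat.of R C) (ModuleCat.of R C) i)

/-- `N` is `C`-projective: it has the form `C ⊗ P` with `P` projective. -/
def IsCProjective (R : Type u) [CommRing R] (C : Type u) [AddCommGroup C] [Module R C]
    (N : Type u) [AddCommGroup N] [Module R N] : Prop :=
  ∃ P : ModuleCat.{u} R, Module.Projective R P ∧ Nonempty (N ≃ₗ[R] C ⊗[R] P)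

/-- `N` has the form `C ⊗ F` with `F` flat. -/
def IsCFlat (R : Type u) [CommRing R] (C : Type u) [AddCommGroup C] [Module R C]
    (N : Type u) [AddCommGroup N] [Module R N] : Prop :=
  ∃ F : ModuleCat.{u} R, Module.Flat R F ∧ Nonempty (N ≃ₗ[R] C ⊗[R] F)

/-- A two-sided sequence of modules and linear maps
`⋯ → L 1 → L 0 → K 0 → K 1 → ⋯`, with the middle map `mid : L 0 → K 0`. -/
structure TwoSidedSeq (R : Type u) [CommRing R] where
  L : ℕ → ModuleCat.{u} R
  K : ℕ → ModuleCat.{u} R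
  dL : ∀ n, L (n + 1) →ₗ[R] L n
  mid : L 0 →ₗ[R] K 0
  dK : ∀ n, K n →ₗ[R] K (n + 1)

namespace TwoSidedSeq

variable {R : Type u} [CommRing R]

/-- The sequence `X` is exact at every term. -/
structure IsExact (X : TwoSidedSeq R) : Prop where
  left : ∀ n, Function.Exact (X.dL (n + 1)) (X.dL n)
  midLeft : Function.Exact (X.dL 0) X.mid
  midRight : Function.Exact X.mid (X.dK 0)
  right : ∀ n, Function.Exact (X.dK n) (X.dK (n + 1))

/-- The sequence `Hom_R(X, W)` is exact at every term. -/
structure IsHomExact (X : TwoSidedSeq R) (W : Type u) [AddCommGroup W] [Module R W] :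
    Prop where
  left : ∀ n, Function.Exact ((X.dL n).lcomp R W) ((X.dL (n + 1)).lcomp R W)
  midLeft : Function.Exact (X.mid.lcomp R W) ((X.dL 0).lcomp R W)
  midRight : Function.Exact ((X.dK 0).lcomp R W) (X.mid.lcomp R W)
  right : ∀ n, Function.Exact ((X.dK (n + 1)).lcomp R W) ((X.dK n).lcomp R W)

/-- The sequence `H ⊗_R X` is exact at every term. -/
structure IsTensorExact (X : TwoSidedSeq R) (H : Type u) [AddCommGroup H] [Module R H] :
    Prop where
  left : ∀ n, Function.Exact ((X.dL (n + 1)).lTensor H) ((X.dL n).lTensor H)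
  midLeft : Function.Exact ((X.dL 0).lTensor H) (X.mid.lTensor H)
  midRight : Function.Exact (X.mid.lTensor H) ((X.dK 0).lTensor H)
  right : ∀ n, Function.Exact ((X.dK n).lTensor H) ((X.dK (n + 1)).lTensor H)

end TwoSidedSeq

/-- `G_C`-projective modules. -/
def IsGCProjective (R : Type u) [CommRing R] (C : Type u) [AddCommGroup C] [Module R C]
    (M : Type u) [AddCommGroup M] [Module R M] : Prop :=
  ∃ X : TwoSidedSeq R,
    (∀ n, Module.Projective R (X.L n)) ∧ (∀ n, IsCProjective R C (X.K n)) ∧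
    X.IsExact ∧ Nonempty (M ≃ₗ[R] LinearMap.range X.mid) ∧
    ∀ (P : Type u) [AddCommGroup P] [Module R P], Module.Projective R P →
      X.IsHomExact (C ⊗[R] P)

/-- `G_C`-flat modules. -/
def IsGCFlat (R : Type u) [CommRing R] (C : Type u) [AddCommGroup C] [Module R C]
    (M : Type u) [AddCommGroup M] [Module R M] : Prop :=
  ∃ X : TwoSidedSeq R,
    (∀ n, Module.Flat R (X.L n)) ∧ (∀ n, IsCFlat R C (X.K n)) ∧
    X.IsExact ∧ Nonempty (M ≃ₗ[R] LinearMap.range X.mid) ∧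
    ∀ (I : Type u) [AddCommGroup I] [Module R I], Module.Injective R I →
      X.IsTensorExact (C →ₗ[R] I)

/-- `R` is `C`-Gorenstein hereditary: every submodule of a projective module is
`G_C`-projective. -/
def IsGCHereditary (R : Type u) [CommRing R] (C : Type u) [AddCommGroup C] [Module R C] :
    Prop :=
  ∀ (P : Type u) [AddCommGroup P] [Module R P], Module.Projective R P →
    ∀ N : Submodule R P, IsGCProjective R C N

/-- `R` is `C`-Gorenstein semihereditary: it is coherent and every submodule of a flat
module is `G_C`-flat. -/
def IsGCSemihereditary (R : Type u) [CommRing R] (C : Type u) [AddCommGroup C]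
    [Module R C] : Prop :=
  IsCoherentRing R ∧
    ∀ (F : Type u) [AddCommGroup F] [Module R F], Module.Flat R F →
      ∀ N : Submodule R F, IsGCFlat R C N

/-!
Write `M = B / A` with `B` projective. Then `A` and `B` are `G_C`-projective, and the mapping cone
of a lift of `A → B` to their `C`-projective coresolutions embeds an arbitrary module `M` in some
`C ⊗ T` whose quotient by `M` embeds in a `C`-projective module. Here `T` is presented by
projectives `P → Q` such that `C ⊗ P → C ⊗ Q` is mono, so that `Tor₁(Y, T) = 0` for every
submodule `Y` of a flat module or of a module `C ⊗ F` with `F` flat.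

For `M = I` injective, `Hom(C, I)` is a retract of `Hom(C, C ⊗ T) = T`, which gives the exactness
of `Hom(C, I) ⊗ 𝕐` for every exact sequence `𝕐` of flat and `C`-flat modules. For `M = N` inside a
flat module or some `C ⊗ F`, the module `T` is itself flat, and the cokernel of `N → C ⊗ T` embeds
in a `C`-flat module, so the construction iterates to a `C`-flat coresolution of `N`.

For coherence, `C` has injective dimension at most one, as do its powers. Applying `Hom(C, -)` to
`0 → C^J → E → E' → 0` yields `Tor₁(Y, R^J) = 0` for the modules `Y` above, and Chase's criterion
applies to every finitely generated ideal `I`: comparing `I` with the first term of its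
`C`-projective coresolution shows that `I ⊗ R^J → I^J` is injective.
-/

variable {R : Type u} [CommRing R]

theorem exists_finset_forall_support_subset {A J W : Type*} [AddCommGroup A] [Module R A]
    [AddCommGroup W] [Module R W] [Module.Finite R A] (φ : A →ₗ[R] J →₀ W) :
    ∃ s : Finset J, ∀ a, (φ a).support ⊆ s := by
  classical
  obtain ⟨t, ht⟩ := Module.Finite.fg_top (R := R) (M := A)
  let s : Finset J := t.biUnion fun a => (φ a).support
  have hle : Submodule.span R (t : Set A) ≤ (Finsupp.supported W R (s : Set J)).comap φ :=
    Submodule.span_le.2 fun a ha =>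
      Finset.coe_subset.2 (Finset.subset_biUnion_of_mem (fun a => (φ a).support) ha)
  exact ⟨s, fun a => Finset.coe_subset.1 (hle (ht ▸ Submodule.mem_top))⟩

/-- Every linear map to `W` that kills `ker f` factors through `f`. For injective `f`, with cokernel
`M` and projective target, this says `Ext¹(M, W) = 0`. -/
def ExtendsAlong {A B : Type*} [AddCommGroup A] [Module R A] [AddCommGroup B] [Module R B]
    (f : A →ₗ[R] B) (W : Type*) [AddCommGroup W] [Module R W] : Prop :=
  ∀ φ : A →ₗ[R] W, LinearMap.ker f ≤ LinearMap.ker φ → ∃ ψ : B →ₗ[R] W, ψ ∘ₗ f = φ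

namespace ExtendsAlong

variable {A A' B M W W' E E' : Type*} [AddCommGroup A] [Module R A] [AddCommGroup A'] [Module R A']
  [AddCommGroup B] [Module R B] [AddCommGroup M] [Module R M] [AddCommGroup W] [Module R W]
  [AddCommGroup W'] [Module R W'] [AddCommGroup E] [Module R E] [AddCommGroup E'] [Module R E']
  {f : A →ₗ[R] B}

variable (W) in
theorem of_surjective (hf : Function.Surjective f) : ExtendsAlong f W := fun φ hφ =>
  ⟨(LinearMap.ker f).liftQ φ hφ ∘ₗ (f.quotKerEquivOfSurjective hf).symm.toLinearMap, by
    ext a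
    rw [LinearMap.comp_apply, LinearMap.comp_apply, LinearEquiv.coe_coe,
      ← f.quotKerEquivOfSurjective_apply_mk hf, LinearEquiv.symm_apply_apply,
      Submodule.liftQ_apply]⟩

theorem of_exact_lcomp {g : B →ₗ[R] M} (hgf : g ∘ₗ f = 0)
    (h : Function.Exact (g.lcomp R W) (f.lcomp R W)) : ExtendsAlong g W := fun φ hφ =>
  (h φ).1 (LinearMap.ext fun a => hφ (LinearMap.congr_fun hgf a))

theorem of_comp {p : A' →ₗ[R] A} (hp : Function.Surjective p) (h : ExtendsAlong (f ∘ₗ p) W) :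
    ExtendsAlong f W := by
  intro φ hφ
  obtain ⟨ψ, hψ⟩ := h (φ ∘ₗ p) fun a ha => hφ ha
  exact ⟨ψ, (LinearMap.cancel_right hp).1 hψ⟩

theorem of_retract (h : ExtendsAlong f W) (s : W' →ₗ[R] W) (r : W →ₗ[R] W')
    (hrs : r ∘ₗ s = LinearMap.id) : ExtendsAlong f W' := by
  intro φ hφ
  obtain ⟨ψ, hψ⟩ := h (s ∘ₗ φ) (hφ.trans (LinearMap.ker_le_ker_comp φ s))
  exact ⟨r ∘ₗ ψ, by rw [LinearMap.comp_assoc, hψ, ← LinearMap.comp_assoc, hrs, LinearMap.id_comp]⟩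

theorem pi (h : ExtendsAlong f W) (J : Type*) : ExtendsAlong f (J → W) := by
  intro φ hφ
  choose ψ hψ using fun j =>
    h (LinearMap.proj j ∘ₗ φ) (hφ.trans (LinearMap.ker_le_ker_comp φ _))
  exact ⟨LinearMap.pi ψ, LinearMap.ext fun a => funext fun j => LinearMap.congr_fun (hψ j) a⟩

theorem finsupp [Module.Finite R A] (h : ExtendsAlong f W) (J : Type*) :
    ExtendsAlong f (J →₀ W) := by
  classical
  intro φ hφ
  obtain ⟨s, hs⟩ := exists_finset_forall_support_subset φ
  choose ψ hψ using fun j =>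
    h (Finsupp.lapply j ∘ₗ φ) (hφ.trans (LinearMap.ker_le_ker_comp φ _))
  refine ⟨∑ j ∈ s, Finsupp.lsingle j ∘ₗ ψ j, ?_⟩
  ext a j
  have hψa : ∀ k, ψ k (f a) = φ a k := fun k => LinearMap.congr_fun (hψ k) a
  simp only [LinearMap.comp_apply, LinearMap.sum_apply, Finsupp.finsetSum_apply,
    Finsupp.lsingle_apply, hψa, Finsupp.single_apply]
  rw [Finset.sum_ite_eq', ite_eq_left_iff]
  exact fun hj => (Finsupp.notMem_support_iff.1 fun hmem => hj (hs a hmem)).symm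

theorem exists_lift [Module.Projective R B] {e : B →ₗ[R] M} (he : Function.Surjective e)
    (hW : ExtendsAlong (LinearMap.ker e).subtype W) {κ : W →ₗ[R] E} {p : E →ₗ[R] E'}
    (hκ : Function.Injective κ) (hκp : Function.Exact κ p) (hp : Function.Surjective p)
    (v : M →ₗ[R] E') : ∃ v' : M →ₗ[R] E, p ∘ₗ v' = v := by
  obtain ⟨w, hw⟩ := Module.projective_lifting_property p (v ∘ₗ e) hp
  have hwker : ∀ x : LinearMap.ker e, w x ∈ LinearMap.range κ := fun x =>
    (hκp _).1 ((LinearMap.congr_fun hw x).trans (by simp))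
  let u := (w.domRestrict (LinearMap.ker e)).codRestrictOfInjective κ hκ hwker
  obtain ⟨h, hh⟩ := hW u (by simp)
  have hκu : ∀ x : LinearMap.ker e, κ (h x) = w x := fun x =>
    (congrArg κ (LinearMap.congr_fun hh x)).trans
      (LinearMap.codRestrictOfInjective_comp_apply _ κ hκ hwker x)
  obtain ⟨v', hv'⟩ := of_surjective E he (w - κ ∘ₗ h) fun x hx => by
    simp [hκu ⟨x, hx⟩]
  refine ⟨v', (LinearMap.cancel_right he).1 ?_⟩
  rw [LinearMap.comp_assoc, hv', LinearMap.comp_sub, hw, ← LinearMap.comp_assoc,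
    hκp.linearMap_comp_eq_zero, LinearMap.zero_comp, sub_zero]

end ExtendsAlong

theorem exists_projective_presentation (R : Type u) [CommRing R] (M : Type u) [AddCommGroup M]
    [Module R M] : ∃ (A B : ModuleCat.{u} R) (i : A →ₗ[R] B) (p : B →ₗ[R] M),
      Module.Projective R B ∧ Function.Injective i ∧ Function.Exact i p ∧
        Function.Surjective p := by
  let p : (M →₀ R) →ₗ[R] M := Finsupp.linearCombination R id
  exact ⟨ModuleCat.of R (LinearMap.ker p), ModuleCat.of R (M →₀ R), (LinearMap.ker p).subtype, p,
    inferInstanceAs (Module.Projective R (M →₀ R)), Submodule.injective_subtype _,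
    p.exact_subtype_ker_map, Finsupp.linearCombination_id_surjective R M⟩

/-- The vanishing of `Tor₁(X, N)`, phrased without derived functors: tensoring with `N` preserves
injectivity of every monomorphism with cokernel `X`. -/
def TorOneVanishes (R : Type u) [CommRing R] (X N : Type u) [AddCommGroup X] [Module R X]
    [AddCommGroup N] [Module R N] : Prop :=
  ∀ (A B : Type u) [AddCommGroup A] [Module R A] [AddCommGroup B] [Module R B]
    (i : A →ₗ[R] B) (p : B →ₗ[R] X), Function.Injective i → Function.Exact i p →
    Function.Surjective p → Function.Injective (i.rTensor N)

namespace TorOneVanishes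

variable {A B X N N' : Type u} [AddCommGroup A] [Module R A] [AddCommGroup B] [Module R B]
  [AddCommGroup X] [Module R X] [AddCommGroup N] [Module R N] [AddCommGroup N'] [Module R N']
  {i : A →ₗ[R] B}

theorem of_presentation [Module.Flat R B] {p : B →ₗ[R] N} (hip : Function.Exact i p)
    (hp : Function.Surjective p) (hi : Function.Injective (i.lTensor X)) :
    TorOneVanishes R X N := by
  intro A' B' _ _ _ _ i' p' hi' hip' hp'
  exact (i'.lTensor_inj_iff_rTensor_inj N).1
    (lTensor_injective_of_exact_of_exact_of_rTensor_injective hip hp hip' hp'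
      ((i.lTensor_inj_iff_rTensor_inj X).1 hi)
      (Module.Flat.lTensor_preserves_injective_linearMap i' hi'))

theorem lTensor_injective (h : TorOneVanishes R X N) {p : B →ₗ[R] X} (hi : Function.Injective i)
    (hip : Function.Exact i p) (hp : Function.Surjective p) :
    Function.Injective (i.lTensor N) :=
  (i.lTensor_inj_iff_rTensor_inj N).2 (h A B i p hi hip hp)

theorem symm (h : TorOneVanishes R X N) : TorOneVanishes R N X := by
  obtain ⟨A, B, i, p, hB, hi, hip, hp⟩ := exists_projective_presentation R X
  exact of_presentation hip hp (h.lTensor_injective hi hip hp)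

theorem of_retract (h : TorOneVanishes R X N) (s : N' →ₗ[R] N) (r : N →ₗ[R] N')
    (hrs : r ∘ₗ s = LinearMap.id) : TorOneVanishes R X N' := by
  intro A B _ _ _ _ i p hi hip hp
  have hs : Function.Injective (s.lTensor A) :=
    Function.LeftInverse.injective (g := r.lTensor A) fun x => by
      rw [← LinearMap.lTensor_comp_apply, hrs, LinearMap.lTensor_id_apply]
  have hcomp : s.lTensor B ∘ₗ i.rTensor N' = i.rTensor N ∘ₗ s.lTensor A := by
    rw [LinearMap.rTensor_comp_lTensor, LinearMap.lTensor_comp_rTensor]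
  have hinj : Function.Injective (s.lTensor B ∘ i.rTensor N') := by
    rw [← LinearMap.coe_comp, hcomp]
    exact (h A B i p hi hip hp).comp hs
  exact hinj.of_comp

theorem of_extension {U V W : Type u} [AddCommGroup U] [Module R U] [AddCommGroup V] [Module R V]
    [AddCommGroup W] [Module R W] {f : U →ₗ[R] V} {g : V →ₗ[R] W} (hf : Function.Injective f)
    (hfg : Function.Exact f g) (hg : Function.Surjective g) (hU : TorOneVanishes R U N)
    (hW : TorOneVanishes R W N) : TorOneVanishes R V N := by
  obtain ⟨A, B, i, p, hB, hi, hip, hp⟩ := exists_projective_presentation R N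
  have hiU : Function.Injective (i.lTensor U) := hU.symm.lTensor_injective hi hip hp
  have hiW : Function.Injective (i.lTensor W) := hW.symm.lTensor_injective hi hip hp
  have hfB : Function.Injective (f.rTensor B) :=
    Module.Flat.rTensor_preserves_injective_linearMap f hf
  refine of_presentation hip hp ((injective_iff_map_eq_zero _).2 fun x hx => ?_)
  have hgx : g.rTensor _ x = 0 := hiW (by
    rw [← LinearMap.comp_apply, LinearMap.lTensor_comp_rTensor, ← LinearMap.rTensor_comp_lTensor,
      LinearMap.comp_apply, hx, map_zero, map_zero])
  obtain ⟨y, rfl⟩ := (rTensor_exact _ hfg hg x).1 hgx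
  have hy : y = 0 := hiU (hfB (by
    rw [← LinearMap.comp_apply, LinearMap.rTensor_comp_lTensor, ← LinearMap.lTensor_comp_rTensor,
      LinearMap.comp_apply, hx, map_zero, map_zero]))
  rw [hy, map_zero]

end TorOneVanishes

section Tensor

variable {A B D X Y Z : Type u} [AddCommGroup A] [Module R A] [AddCommGroup B] [Module R B]
  [AddCommGroup D] [Module R D] [AddCommGroup X] [Module R X] [AddCommGroup Y] [Module R Y]
  [AddCommGroup Z] [Module R Z]

theorem flat_of_forall_torOneVanishes
    (h : ∀ (Y : Type u) [AddCommGroup Y] [Module R Y], TorOneVanishes R Y X) :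
    Module.Flat R X :=
  Module.Flat.iff_rTensor_preserves_injective_linearMap.2 fun A B _ _ _ _ i hi =>
    h (B ⧸ LinearMap.range i) A B i _ hi i.exact_map_mkQ_range (Submodule.mkQ_surjective _)

theorem exact_rangeRestrict {f : A →ₗ[R] B} {g : B →ₗ[R] D} (hfg : Function.Exact f g) :
    Function.Exact f g.rangeRestrict :=
  ((Submodule.injective_subtype _).comp_exact_iff_exact (i := (LinearMap.range g).subtype)).1 hfg

theorem lTensor_exact_of_torOneVanishes {f : A →ₗ[R] B} {g : B →ₗ[R] D}
    {h : D →ₗ[R] Y} (hfg : Function.Exact f g) (hgh : Function.Exact g h)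
    (hX : TorOneVanishes R (LinearMap.range h) X) :
    Function.Exact (f.lTensor X) (g.lTensor X) := by
  have hincl : Function.Injective ((LinearMap.range g).subtype.lTensor X) :=
    hX.lTensor_injective (Submodule.injective_subtype _) hgh.linearMap_rangeRestrict
      h.surjective_rangeRestrict
  have hcomp : g.lTensor X =
      (LinearMap.range g).subtype.lTensor X ∘ₗ g.rangeRestrict.lTensor X := by
    rw [← LinearMap.lTensor_comp, LinearMap.subtype_comp_codRestrict]
  rw [hcomp, hincl.comp_exact_iff_exact]
  exact lTensor_exact X (exact_rangeRestrict hfg) g.surjective_rangeRestrict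

theorem lTensor_injective_of_injective [Module.Flat R A] {k : Y →ₗ[R] Z}
    (hk : Function.Injective k) {f : A →ₗ[R] B} (hf : Function.Injective (f.lTensor Z)) :
    Function.Injective (f.lTensor Y) := by
  have hcomp : k.rTensor B ∘ₗ f.lTensor Y = f.lTensor Z ∘ₗ k.rTensor A := by
    rw [LinearMap.rTensor_comp_lTensor, LinearMap.lTensor_comp_rTensor]
  have hinj : Function.Injective (k.rTensor B ∘ f.lTensor Y) := by
    rw [← LinearMap.coe_comp, hcomp]
    exact hf.comp (Module.Flat.rTensor_preserves_injective_linearMap k hk)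
  exact hinj.of_comp

theorem lTensor_tensorProduct_injective_iff {f : A →ₗ[R] B} :
    Function.Injective (f.lTensor (X ⊗[R] Y)) ↔ Function.Injective ((f.lTensor Y).lTensor X) := by
  rw [LinearMap.lTensor_tensor]
  simp

end Tensor

section Unit

variable {C P Q : Type u} [AddCommGroup C] [Module R C] [AddCommGroup P] [Module R P]
  [AddCommGroup Q] [Module R Q]

theorem lTensor_comp_mk_flip (f : P →ₗ[R] Q) (p : P) :
    f.lTensor C ∘ₗ (TensorProduct.mk R C P).flip p = (TensorProduct.mk R C Q).flip (f p) := rfl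

theorem mk_flip_bijective_of_retract (s : P →ₗ[R] Q) (r : Q →ₗ[R] P)
    (hrs : r ∘ₗ s = LinearMap.id) (hQ : Function.Bijective (TensorProduct.mk R C Q).flip) :
    Function.Bijective (TensorProduct.mk R C P).flip := by
  have hs : Function.Injective s :=
    Function.LeftInverse.injective (LinearMap.congr_fun hrs)
  constructor
  · refine (injective_iff_map_eq_zero _).2 fun p hp => hs (hQ.1 ?_)
    rw [← lTensor_comp_mk_flip, hp, LinearMap.comp_zero, map_zero, map_zero]
  · intro v
    obtain ⟨q, hq⟩ := hQ.2 (s.lTensor C ∘ₗ v)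
    refine ⟨r q, ?_⟩
    rw [← lTensor_comp_mk_flip, hq, ← LinearMap.comp_assoc, ← LinearMap.lTensor_comp, hrs,
      LinearMap.lTensor_id, LinearMap.id_comp]

theorem exists_retract_finsupp (C P : Type u) [AddCommGroup C] [Module R C] [AddCommGroup P]
    [Module R P] [Module.Projective R P] :
    ∃ (s : C ⊗[R] P →ₗ[R] P →₀ C) (r : (P →₀ C) →ₗ[R] C ⊗[R] P), r ∘ₗ s = LinearMap.id := by
  classical
  obtain ⟨σ, hσ⟩ := Module.projective_def'.1 (inferInstance : Module.Projective R P)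
  let e : C ⊗[R] (P →₀ R) ≃ₗ[R] P →₀ C := TensorProduct.finsuppScalarRight R R C P
  refine ⟨e.toLinearMap ∘ₗ σ.lTensor C,
    (Finsupp.linearCombination R id).lTensor C ∘ₗ e.symm.toLinearMap, LinearMap.ext fun t => ?_⟩
  rw [LinearMap.comp_apply, LinearMap.comp_apply, LinearMap.comp_apply, LinearEquiv.coe_coe,
    LinearEquiv.coe_coe, e.symm_apply_apply, ← LinearMap.lTensor_comp_apply, hσ,
    LinearMap.lTensor_id]

end Unit

theorem ExtendsAlong.of_subsingleton_ext {A B M W : Type u} [AddCommGroup A] [Module R A]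
    [AddCommGroup B] [Module R B] [AddCommGroup M] [Module R M] [AddCommGroup W] [Module R W]
    (h : Subsingleton (CategoryTheory.Abelian.Ext (ModuleCat.of R M) (ModuleCat.of R W) 1))
    {i : A →ₗ[R] B} {p : B →ₗ[R] M} (hi : Function.Injective i) (hip : Function.Exact i p)
    (hp : Function.Surjective p) : ExtendsAlong i W := by
  intro φ _
  let S : CategoryTheory.ShortComplex (ModuleCat.{u} R) :=
    .mk (ModuleCat.ofHom i) (ModuleCat.ofHom p) (ModuleCat.hom_ext hip.linearMap_comp_eq_zero)
  have hS : S.ShortExact := ModuleCat.shortComplex_shortExact S hip hi hp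
  obtain ⟨x, hx⟩ := CategoryTheory.Abelian.Ext.contravariant_sequence_exact₁ hS
    (ModuleCat.of R W) (CategoryTheory.Abelian.Ext.mk₀ (ModuleCat.ofHom φ)) (n₁ := 1) rfl
    (h.elim _ _)
  obtain ⟨ψ, rfl⟩ := (CategoryTheory.Abelian.Ext.mk₀_bijective _ _).2 x
  rw [CategoryTheory.Abelian.Ext.mk₀_comp_mk₀] at hx
  exact ⟨ψ.hom, congrArg ModuleCat.Hom.hom ((CategoryTheory.Abelian.Ext.mk₀_bijective _ _).1 hx)⟩

namespace IsSemidualizing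

variable {C : Type u} [AddCommGroup C] [Module R C]

theorem exists_presentation (hC : IsSemidualizing R C) :
    ∃ (B : ModuleCat.{u} R) (e : B →ₗ[R] C), Module.Projective R B ∧ Module.Finite R B ∧
      Function.Surjective e ∧ (LinearMap.ker e).FG ∧
      ExtendsAlong (LinearMap.ker e).subtype C := by
  obtain ⟨P, d, ε, hP, hε, hdε, -⟩ := hC.resolution
  have := (hP 1).2
  exact ⟨P 0, ε, (hP 0).1, (hP 0).2, hε, hdε.linearMap_ker_eq ▸ Submodule.FG.of_finite,
    .of_subsingleton_ext (hC.ext_eq_zero 1 le_rfl) (Submodule.injective_subtype _)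
      ε.exact_subtype_ker_map hε⟩

theorem finitePresentation (hC : IsSemidualizing R C) : Module.FinitePresentation R C := by
  obtain ⟨B, e, _, _, he, hker, -⟩ := hC.exists_presentation
  have := Module.finitePresentation_of_projective R B
  exact Module.finitePresentation_of_surjective e he hker

theorem mk_flip_bijective_finsupp (hC : IsSemidualizing R C) (J : Type u) :
    Function.Bijective (TensorProduct.mk R C (J →₀ R)).flip := by
  classical
  have := hC.finitePresentation
  let e : C ⊗[R] (J →₀ R) ≃ₗ[R] J →₀ C := TensorProduct.finsuppScalarRight R R C J
  have he : ∀ c x j, e (c ⊗ₜ[R] x) j = x j • c := fun c x j =>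
    TensorProduct.finsuppScalarRight_apply_tmul_apply c x j
  constructor
  · refine (injective_iff_map_eq_zero _).2 fun x hx => Finsupp.ext fun j => hC.homothety.1 ?_
    ext c
    have hcx : c ⊗ₜ[R] x = 0 := LinearMap.congr_fun hx c
    simpa [hcx] using (he c x j).symm
  · intro v
    obtain ⟨s, hs⟩ := exists_finset_forall_support_subset (e.toLinearMap ∘ₗ v)
    choose r hr using fun j => hC.homothety.2 (Finsupp.lapply j ∘ₗ e.toLinearMap ∘ₗ v)
    have hrv : ∀ j c, r j • c = e (v c) j := fun j c => LinearMap.congr_fun (hr j) c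
    refine ⟨∑ j ∈ s, Finsupp.single j (r j), LinearMap.ext fun c => e.injective ?_⟩
    ext j
    rw [LinearMap.flip_apply, TensorProduct.mk_apply, he, Finsupp.finsetSum_apply]
    simp only [Finsupp.single_apply]
    rw [Finset.sum_ite_eq']
    split_ifs with hj
    · exact hrv j c
    · rw [zero_smul]
      exact (Finsupp.notMem_support_iff.1 fun hmem => hj (hs c hmem)).symm

theorem mk_flip_bijective (hC : IsSemidualizing R C) (P : Type u) [AddCommGroup P] [Module R P]
    [Module.Projective R P] : Function.Bijective (TensorProduct.mk R C P).flip := by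
  obtain ⟨σ, hσ⟩ := Module.projective_def'.1 (inferInstance : Module.Projective R P)
  exact mk_flip_bijective_of_retract σ _ hσ (hC.mk_flip_bijective_finsupp P)

theorem exists_lTensor_eq (hC : IsSemidualizing R C) {P Q : Type u} [AddCommGroup P]
    [Module R P] [AddCommGroup Q] [Module R Q] [Module.Projective R Q]
    (φ : C ⊗[R] P →ₗ[R] C ⊗[R] Q) : ∃ f : P →ₗ[R] Q, f.lTensor C = φ := by
  let η := LinearEquiv.ofBijective _ (hC.mk_flip_bijective Q)
  refine ⟨η.symm.toLinearMap ∘ₗ LinearMap.llcomp R C _ _ φ ∘ₗ (TensorProduct.mk R C P).flip, ?_⟩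
  ext c p
  exact LinearMap.congr_fun
    (η.apply_symm_apply (φ ∘ₗ (TensorProduct.mk R C P).flip p)) c

end IsSemidualizing

/-- `T` has a projective presentation `P → Q → T → 0` such that `C ⊗ P → C ⊗ Q` is a
monomorphism; then `0 → C ⊗ P → C ⊗ Q → C ⊗ T → 0` is a resolution of `C ⊗ T`. -/
def HasCMonicPresentation (R : Type u) [CommRing R] (C T : Type u) [AddCommGroup C] [Module R C]
    [AddCommGroup T] [Module R T] : Prop :=
  ∃ (P Q : ModuleCat.{u} R) (f : P →ₗ[R] Q) (g : Q →ₗ[R] T),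
    Module.Projective R P ∧ Module.Projective R Q ∧ Function.Exact f g ∧
      Function.Surjective g ∧ Function.Injective (f.lTensor C)

/-- `Y` embeds in a flat module or in a module `C ⊗ F` with `F` flat. These are the modules for
which `Tor₁(Y, T) = 0` whenever `T` has a `C`-monic presentation. -/
def EmbedsInFlatOrCFlat (R : Type u) [CommRing R] (C Y : Type u) [AddCommGroup C] [Module R C]
    [AddCommGroup Y] [Module R Y] : Prop :=
  ∃ (Z : ModuleCat.{u} R) (k : Y →ₗ[R] Z), Function.Injective k ∧
    (Module.Flat R Z ∨ IsCFlat R C Z)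

section CProjective

variable {C W W' Y : Type u} [AddCommGroup C] [Module R C] [AddCommGroup W] [Module R W]
  [AddCommGroup W'] [Module R W'] [AddCommGroup Y] [Module R Y]

theorem IsCProjective.isCFlat (h : IsCProjective R C W) : IsCFlat R C W := by
  obtain ⟨P, hP, e⟩ := h
  exact ⟨P, inferInstance, e⟩

theorem IsCProjective.prod (h : IsCProjective R C W) (h' : IsCProjective R C W') :
    IsCProjective R C (W × W') := by
  obtain ⟨P, hP, ⟨e⟩⟩ := h
  obtain ⟨P', hP', ⟨e'⟩⟩ := h'
  exact ⟨ModuleCat.of R (P × P'), inferInstanceAs (Module.Projective R (P × P')),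
    ⟨(e.prodCongr e').trans (TensorProduct.prodRight R R C P P').symm⟩⟩

theorem EmbedsInFlatOrCFlat.of_flat [Module.Flat R W] {k : Y →ₗ[R] W}
    (hk : Function.Injective k) : EmbedsInFlatOrCFlat R C Y :=
  ⟨ModuleCat.of R W, k, hk, .inl ‹_›⟩

theorem IsCFlat.embedsInFlatOrCFlat_range (h : IsCFlat R C W) (f : Y →ₗ[R] W) :
    EmbedsInFlatOrCFlat R C (LinearMap.range f) :=
  ⟨ModuleCat.of R W, (LinearMap.range f).subtype, Submodule.injective_subtype _, .inr h⟩

theorem IsSemidualizing.injective_of_lTensor (hC : IsSemidualizing R C) {P Q : Type u}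
    [AddCommGroup P] [Module R P] [AddCommGroup Q] [Module R Q] [Module.Projective R P]
    {f : P →ₗ[R] Q} (hf : Function.Injective (f.lTensor C)) : Function.Injective f := by
  refine (injective_iff_map_eq_zero f).2 fun p hp => (hC.mk_flip_bijective P).1 ?_
  ext c
  refine hf ?_
  simp [hp]

end CProjective

namespace HasCMonicPresentation

variable {C T Y : Type u} [AddCommGroup C] [Module R C] [AddCommGroup T] [Module R T]
  [AddCommGroup Y] [Module R Y]

theorem torOneVanishes (hT : HasCMonicPresentation R C T) (hC : IsSemidualizing R C)
    (hY : EmbedsInFlatOrCFlat R C Y) : TorOneVanishes R Y T := by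
  obtain ⟨P, Q, f, g, _, _, hfg, hg, hf⟩ := hT
  obtain ⟨Z, k, hk, hZ⟩ := hY
  refine .of_presentation hfg hg ?_
  obtain hZ | ⟨F, hF, ⟨e⟩⟩ := hZ
  · exact lTensor_injective_of_injective hk
      (Module.Flat.lTensor_preserves_injective_linearMap f (hC.injective_of_lTensor hf))
  · let e' : Z ≃ₗ[R] F ⊗[R] C := e.trans (TensorProduct.comm R C F)
    exact lTensor_injective_of_injective (k := e'.toLinearMap ∘ₗ k) (e'.injective.comp hk)
      (lTensor_tensorProduct_injective_iff.2
        (Module.Flat.lTensor_preserves_injective_linearMap _ hf))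

theorem mk_flip_bijective (hT : HasCMonicPresentation R C T) (hC : IsSemidualizing R C) :
    Function.Bijective (TensorProduct.mk R C T).flip := by
  obtain ⟨P, Q, f, g, _, _, hfg, hg, hf⟩ := hT
  have hexact := lTensor_exact C hfg hg
  constructor
  · refine (injective_iff_map_eq_zero _).2 fun t ht => ?_
    obtain ⟨y, rfl⟩ := hg t
    have hmem : ∀ c, c ⊗ₜ[R] y ∈ LinearMap.range (f.lTensor C) := fun c =>
      (hexact _).1 (LinearMap.congr_fun ht c)
    obtain ⟨x, hx⟩ := (hC.mk_flip_bijective P).2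
      (((TensorProduct.mk R C Q).flip y).codRestrictOfInjective _ hf hmem)
    refine (hfg y).2 ⟨x, (hC.mk_flip_bijective Q).1 ?_⟩
    rw [← lTensor_comp_mk_flip, hx]
    exact LinearMap.ext (LinearMap.codRestrictOfInjective_comp_apply _ _ hf hmem)
  · intro v
    obtain ⟨B, e, _, _, he, hker, hext⟩ := hC.exists_presentation
    obtain ⟨s, r, hrs⟩ := exists_retract_finsupp (R := R) C P
    have := Module.Finite.iff_fg.2 hker
    obtain ⟨w, rfl⟩ := ((hext.finsupp P).of_retract s r hrs).exists_lift he hf hexact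
      (LinearMap.lTensor_surjective C hg) v
    obtain ⟨y, rfl⟩ := (hC.mk_flip_bijective Q).2 w
    exact ⟨g y, rfl⟩

end HasCMonicPresentation

theorem IsCProjective.extendsAlong_of_exact_lcomp {A B C D W : Type u} [AddCommGroup A]
    [Module R A] [AddCommGroup B] [Module R B] [AddCommGroup C] [Module R C] [AddCommGroup D]
    [Module R D] [AddCommGroup W] [Module R W] (hW : IsCProjective R C W) {f : A →ₗ[R] B}
    {g : B →ₗ[R] D} (hfg : Function.Exact f g)
    (h : ∀ (P : Type u) [AddCommGroup P] [Module R P], Module.Projective R P →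
      Function.Exact (g.lcomp R (C ⊗[R] P)) (f.lcomp R (C ⊗[R] P))) : ExtendsAlong g W := by
  obtain ⟨P, hP, ⟨e⟩⟩ := hW
  exact (ExtendsAlong.of_exact_lcomp hfg.linearMap_comp_eq_zero (h P hP)).of_retract
    e.toLinearMap e.symm.toLinearMap e.symm_comp

namespace IsGCProjective

variable {C M M' : Type u} [AddCommGroup C] [Module R C] [AddCommGroup M] [Module R M]
  [AddCommGroup M'] [Module R M']

theorem of_equiv (h : IsGCProjective R C M) (e : M' ≃ₗ[R] M) : IsGCProjective R C M' := by
  obtain ⟨X, hL, hK, hX, ⟨e'⟩, hW⟩ := h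
  exact ⟨X, hL, hK, hX, ⟨e.trans e'⟩, hW⟩

theorem exists_presentation (h : IsGCProjective R C M) :
    ∃ (L : ModuleCat.{u} R) (q : L →ₗ[R] M), Module.Projective R L ∧ Function.Surjective q ∧
      ExtendsAlong (LinearMap.ker q).subtype C := by
  obtain ⟨X, hL, -, hX, ⟨e⟩, hW⟩ := h
  let q : X.L 0 →ₗ[R] M := e.symm.toLinearMap ∘ₗ X.mid.rangeRestrict
  have hker : LinearMap.ker q = LinearMap.range (X.dL 0) := by
    rw [LinearEquiv.ker_comp, LinearMap.ker_rangeRestrict, hX.midLeft.linearMap_ker_eq]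
  refine ⟨X.L 0, q, hL 0, e.symm.surjective.comp X.mid.surjective_rangeRestrict, ?_⟩
  have hCC : IsCProjective R C C :=
    ⟨ModuleCat.of R R, inferInstanceAs (Module.Projective R R), ⟨(TensorProduct.rid R C).symm⟩⟩
  rw [hker]
  exact .of_comp (X.dL 0).surjective_rangeRestrict
    (hCC.extendsAlong_of_exact_lcomp (hX.left 0) fun P _ _ hP => (hW P hP).left 0)

end IsGCProjective

/-- The first terms `0 → M → K₀ → K₁ → K₂` of a coresolution of `M` by `C`-projective modules to
which `Hom(-, W)` applies without loss of exactness for every `C`-projective `W`. -/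
structure CProjectiveCopresentation (R : Type u) [CommRing R] (C M : Type u) [AddCommGroup C]
    [Module R C] [AddCommGroup M] [Module R M] where
  K₀ : ModuleCat.{u} R
  K₁ : ModuleCat.{u} R
  K₂ : ModuleCat.{u} R
  a : M →ₗ[R] K₀
  d₀ : K₀ →ₗ[R] K₁
  d₁ : K₁ →ₗ[R] K₂
  isCProjective₀ : IsCProjective R C K₀
  isCProjective₁ : IsCProjective R C K₁
  isCProjective₂ : IsCProjective R C K₂
  injective_a : Function.Injective a
  exact_a_d₀ : Function.Exact a d₀
  exact_d₀_d₁ : Function.Exact d₀ d₁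
  extendsAlong_a : ∀ W : ModuleCat.{u} R, IsCProjective R C W → ExtendsAlong a W
  extendsAlong_d₀ : ∀ W : ModuleCat.{u} R, IsCProjective R C W → ExtendsAlong d₀ W

theorem IsGCProjective.nonempty_copresentation {C M : Type u} [AddCommGroup C] [Module R C]
    [AddCommGroup M] [Module R M] (h : IsGCProjective R C M) :
    Nonempty (CProjectiveCopresentation R C M) := by
  obtain ⟨X, -, hK, hX, ⟨e⟩, hW⟩ := h
  let a : M →ₗ[R] X.K 0 := (LinearMap.range X.mid).subtype ∘ₗ e.toLinearMap
  let q : X.L 0 →ₗ[R] M := e.symm.toLinearMap ∘ₗ X.mid.rangeRestrict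
  have haq : a ∘ₗ q = X.mid := LinearMap.ext fun x => by simp [a, q]
  have hq : Function.Surjective q := e.symm.surjective.comp X.mid.surjective_rangeRestrict
  exact ⟨{
    K₀ := X.K 0
    K₁ := X.K 1
    K₂ := X.K 2
    a := a
    d₀ := X.dK 0
    d₁ := X.dK 1
    isCProjective₀ := hK 0
    isCProjective₁ := hK 1
    isCProjective₂ := hK 2
    injective_a := (Submodule.injective_subtype _).comp e.injective
    exact_a_d₀ := by
      refine (hq.comp_exact_iff_exact (p := q)).1 ?_
      rw [haq]
      exact hX.midRight
    exact_d₀_d₁ := hX.right 0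
    extendsAlong_a := fun W hCW => .of_comp hq <| haq ▸
      hCW.extendsAlong_of_exact_lcomp hX.midLeft fun P _ _ hP => (hW P hP).midLeft
    extendsAlong_d₀ := fun W hCW =>
      hCW.extendsAlong_of_exact_lcomp hX.midRight fun P _ _ hP => (hW P hP).midRight }⟩

theorem IsGCHereditary.isGCProjective_of_injective {C A B : Type u} [AddCommGroup C] [Module R C]
    [AddCommGroup A] [Module R A] [AddCommGroup B] [Module R B] [Module.Projective R B]
    (hR : IsGCHereditary R C) {i : A →ₗ[R] B} (hi : Function.Injective i) :
    IsGCProjective R C A :=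
  (hR B inferInstance (LinearMap.range i)).of_equiv (LinearEquiv.ofInjective i hi)

section Cone

variable {A₀ A₁ A₂ B₀ B₁ B₂ : Type*} [AddCommGroup A₀] [Module R A₀] [AddCommGroup A₁] [Module R A₁]
  [AddCommGroup A₂] [Module R A₂] [AddCommGroup B₀] [Module R B₀] [AddCommGroup B₁] [Module R B₁]
  [AddCommGroup B₂] [Module R B₂]

/-- The differential `(x, y) ↦ (b x + e y, -a y)` of a mapping cone. -/
def coneMap (a : A₀ →ₗ[R] A₁) (b : B₀ →ₗ[R] B₁) (e : A₀ →ₗ[R] B₁) : B₀ × A₀ →ₗ[R] B₁ × A₁ :=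
  (LinearMap.inl R B₁ A₁ ∘ₗ b).coprod (e.prod (-a))

theorem coneMap_apply (a : A₀ →ₗ[R] A₁) (b : B₀ →ₗ[R] B₁) (e : A₀ →ₗ[R] B₁) (x : B₀ × A₀) :
    coneMap a b e x = (b x.1 + e x.2, -a x.2) := by
  simp [coneMap]

theorem exact_coneMap {a₀ : A₀ →ₗ[R] A₁} {a₁ : A₁ →ₗ[R] A₂} {b₀ : B₀ →ₗ[R] B₁}
    {b₁ : B₁ →ₗ[R] B₂} {e₀ : A₀ →ₗ[R] B₁} {e₁ : A₁ →ₗ[R] B₂} (ha : Function.Exact a₀ a₁)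
    (hb : Function.Exact b₀ b₁) (he : e₁ ∘ₗ a₀ = b₁ ∘ₗ e₀) :
    Function.Exact (coneMap a₀ b₀ e₀) (coneMap a₁ b₁ e₁) := by
  have he' : ∀ x, e₁ (a₀ x) = b₁ (e₀ x) := LinearMap.congr_fun he
  rintro ⟨y, x⟩
  simp only [coneMap_apply, Set.mem_range, Prod.mk_eq_zero, neg_eq_zero, Prod.mk.injEq]
  constructor
  · rintro ⟨hy, hx⟩
    obtain ⟨x', rfl⟩ := (ha x).1 hx
    obtain ⟨y', hy'⟩ := (hb (y + e₀ x')).1 (by rw [map_add, ← he', hy])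
    exact ⟨(y', -x'), by simp [hy'], by simp⟩
  · rintro ⟨⟨y', x'⟩, rfl, rfl⟩
    simp [he', ha.apply_apply_eq_zero, hb.apply_apply_eq_zero]

theorem exists_exact_of_exact_coprod {B L M T W X : Type*} [AddCommGroup B] [Module R B]
    [AddCommGroup L] [Module R L] [AddCommGroup M] [Module R M] [AddCommGroup T] [Module R T]
    [AddCommGroup W] [Module R W] [AddCommGroup X] [Module R X] {j : B →ₗ[R] L} {κ : X →ₗ[R] L}
    {D : L →ₗ[R] W} (hD : Function.Exact (j.coprod κ) D) {p : B →ₗ[R] M}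
    (hp : Function.Surjective p) (hpj : ∀ x, p x = 0 ↔ j x ∈ LinearMap.range κ)
    {q : L →ₗ[R] T} (hq : Function.Surjective q) (hκq : Function.Exact κ q) :
    ∃ (ι : M →ₗ[R] T) (δ : T →ₗ[R] W), Function.Injective ι ∧ Function.Exact ι δ := by
  have hqj : ∀ x, q (j x) = 0 ↔ p x = 0 := fun x => (hκq _).trans (hpj x).symm
  obtain ⟨ι, hι⟩ := ExtendsAlong.of_surjective T hp (q ∘ₗ j) fun x hx => (hqj x).2 hx
  obtain ⟨δ, hδ⟩ := ExtendsAlong.of_surjective W hq D fun y hy => by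
    obtain ⟨k, rfl⟩ := (hκq y).1 hy
    exact (hD _).2 ⟨(0, k), by simp⟩
  have hι' : ∀ x, ι (p x) = q (j x) := LinearMap.congr_fun hι
  have hδ' : ∀ y, δ (q y) = D y := LinearMap.congr_fun hδ
  refine ⟨ι, δ, (injective_iff_map_eq_zero ι).2 fun m hm => ?_, fun t => ?_⟩
  · obtain ⟨x, rfl⟩ := hp m
    exact (hqj x).1 ((hι' x).symm.trans hm)
  · obtain ⟨y, rfl⟩ := hq t
    rw [hδ', hD y]
    constructor
    · rintro ⟨⟨x, k⟩, rfl⟩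
      exact ⟨p x, by simp [hι', hκq.apply_apply_eq_zero]⟩
    · rintro ⟨m, hm⟩
      obtain ⟨x, rfl⟩ := hp m
      rw [hι'] at hm
      obtain ⟨k, hk⟩ := (hκq (y - j x)).1 (by rw [map_sub, hm, sub_self])
      exact ⟨(x, k), by simp [hk]⟩

end Cone

section Embedding

variable {C : Type u} [AddCommGroup C] [Module R C]

theorem IsSemidualizing.exists_hasCMonicPresentation (hC : IsSemidualizing R C) {X L : Type u}
    [AddCommGroup X] [Module R X] [AddCommGroup L] [Module R L] (hX : IsCProjective R C X)
    (hL : IsCProjective R C L) {κ : X →ₗ[R] L} (hκ : Function.Injective κ) :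
    ∃ (T : ModuleCat.{u} R) (q : L →ₗ[R] C ⊗[R] T), HasCMonicPresentation R C T ∧
      Function.Surjective q ∧ Function.Exact κ q := by
  obtain ⟨P, hP, ⟨eP⟩⟩ := hX
  obtain ⟨Q, hQ, ⟨eQ⟩⟩ := hL
  obtain ⟨f, hf⟩ := hC.exists_lTensor_eq (eQ.toLinearMap ∘ₗ κ ∘ₗ eP.symm.toLinearMap)
  have hg : Function.Surjective (LinearMap.range f).mkQ := Submodule.mkQ_surjective _
  have hfg : Function.Exact f (LinearMap.range f).mkQ := f.exact_map_mkQ_range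
  refine ⟨ModuleCat.of R (Q ⧸ LinearMap.range f),
    (LinearMap.range f).mkQ.lTensor C ∘ₗ eQ.toLinearMap,
    ⟨P, Q, f, _, hP, hQ, hfg, hg, ?_⟩, (LinearMap.lTensor_surjective C hg).comp eQ.surjective, ?_⟩
  · rw [hf]
    exact eQ.injective.comp (hκ.comp eP.symm.injective)
  · exact Function.Exact.of_ladder_linearEquiv_of_exact (e₁ := eP.symm) (e₂ := eQ.symm)
      (e₃ := LinearEquiv.refl R _) (by ext; simp [hf]) (by ext; simp) (lTensor_exact C hfg hg)

theorem CProjectiveCopresentation.exists_lift {A B : Type u} [AddCommGroup A] [Module R A]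
    [AddCommGroup B] [Module R B] (X : CProjectiveCopresentation R C A)
    (Y : CProjectiveCopresentation R C B) (i : A →ₗ[R] B) :
    ∃ (e₀ : X.K₀ →ₗ[R] Y.K₀) (e₁ : X.K₁ →ₗ[R] Y.K₁), e₀ ∘ₗ X.a = Y.a ∘ₗ i ∧
      e₁ ∘ₗ X.d₀ = Y.d₀ ∘ₗ e₀ := by
  obtain ⟨e₀, he₀⟩ := X.extendsAlong_a _ Y.isCProjective₀ (Y.a ∘ₗ i) (by
    rw [LinearMap.ker_eq_bot.2 X.injective_a]
    exact bot_le)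
  obtain ⟨e₁, he₁⟩ := X.extendsAlong_d₀ _ Y.isCProjective₁ (Y.d₀ ∘ₗ e₀) fun k hk => by
    obtain ⟨x, rfl⟩ := (X.exact_a_d₀ k).1 hk
    have he₀x : e₀ (X.a x) = Y.a (i x) := LinearMap.congr_fun he₀ x
    simp [he₀x, Y.exact_a_d₀.apply_apply_eq_zero]
  exact ⟨e₀, e₁, he₀, he₁⟩

theorem CProjectiveCopresentation.exists_embedding (hC : IsSemidualizing R C) {A B M : Type u}
    [AddCommGroup A] [Module R A] [AddCommGroup B] [Module R B] [AddCommGroup M] [Module R M]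
    (X : CProjectiveCopresentation R C A) (Y : CProjectiveCopresentation R C B)
    {i : A →ₗ[R] B} {p : B →ₗ[R] M} (hi : Function.Injective i) (hip : Function.Exact i p)
    (hp : Function.Surjective p) :
    ∃ (T W : ModuleCat.{u} R) (ι : M →ₗ[R] C ⊗[R] T) (δ : C ⊗[R] T →ₗ[R] W),
      HasCMonicPresentation R C T ∧ IsCProjective R C W ∧ Function.Injective ι ∧
        Function.Exact ι δ := by
  -- The cone of `e` is `X.K₀ → Y.K₀ × X.K₁ → Y.K₁ × X.K₂`, with `M` as cohomology in the middle;
  -- `j` induces the embedding of `M` in the cokernel of `κ`.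
  obtain ⟨e₀, e₁, he₀, he₁⟩ := X.exists_lift Y i
  let j : B →ₗ[R] Y.K₀ × X.K₁ := LinearMap.inl R Y.K₀ X.K₁ ∘ₗ Y.a
  let κ : X.K₀ →ₗ[R] Y.K₀ × X.K₁ := e₀.prod (-X.d₀)
  have hjκ : ∀ x k, j x = κ k ↔ ∃ y, i y = x ∧ X.a y = k := fun x k => by
    have he₀' : ∀ y, e₀ (X.a y) = Y.a (i y) := LinearMap.congr_fun he₀
    have hprod : j x = κ k ↔ Y.a x = e₀ k ∧ X.d₀ k = 0 := by
      simp [j, κ, Prod.ext_iff]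
    rw [hprod]
    constructor
    · rintro ⟨hx, hk⟩
      obtain ⟨y, rfl⟩ := (X.exact_a_d₀ k).1 hk
      exact ⟨y, Y.injective_a (by rw [hx, he₀']), rfl⟩
    · rintro ⟨y, rfl, rfl⟩
      exact ⟨(he₀' y).symm, X.exact_a_d₀.apply_apply_eq_zero y⟩
  have hκ : Function.Injective κ := (injective_iff_map_eq_zero κ).2 fun k hk => by
    obtain ⟨y, hy, rfl⟩ := (hjκ 0 k).1 ((map_zero j).trans hk.symm)
    rw [(map_eq_zero_iff i hi).1 hy, map_zero]
  obtain ⟨T, q, hT, hq, hκq⟩ := hC.exists_hasCMonicPresentation X.isCProjective₀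
    (Y.isCProjective₀.prod X.isCProjective₁) hκ
  have hpj : ∀ x, p x = 0 ↔ j x ∈ LinearMap.range κ := fun x => by
    simp [eq_comm (a := κ _), hjκ, hip x]
  obtain ⟨ι, δ, hι, hιδ⟩ := exists_exact_of_exact_coprod
    (exact_coneMap X.exact_d₀_d₁ Y.exact_a_d₀ he₁) hp hpj hq hκq
  exact ⟨T, ModuleCat.of R (Y.K₁ × X.K₂), ι, δ, hT, Y.isCProjective₁.prod X.isCProjective₂, hι, hιδ⟩

theorem IsGCHereditary.exists_embedding (hC : IsSemidualizing R C) (hR : IsGCHereditary R C)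
    (M : Type u) [AddCommGroup M] [Module R M] :
    ∃ (T W : ModuleCat.{u} R) (ι : M →ₗ[R] C ⊗[R] T) (δ : C ⊗[R] T →ₗ[R] W),
      HasCMonicPresentation R C T ∧ IsCProjective R C W ∧ Function.Injective ι ∧
        Function.Exact ι δ := by
  obtain ⟨A, B, i, p, _, hi, hip, hp⟩ := exists_projective_presentation R M
  obtain ⟨X⟩ := (hR.isGCProjective_of_injective hi).nonempty_copresentation
  obtain ⟨Y⟩ := (hR.isGCProjective_of_injective (i := LinearMap.id (R := R) (M := B))
    Function.injective_id).nonempty_copresentation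
  exact X.exists_embedding hC Y hi hip hp

end Embedding

section Flatness

variable {C : Type u} [AddCommGroup C] [Module R C]

theorem HasCMonicPresentation.exists_hom_retract {T I : Type u} [AddCommGroup T] [Module R T]
    [AddCommGroup I] [Module R I] [Module.Injective R I] (hT : HasCMonicPresentation R C T)
    (hC : IsSemidualizing R C) {ι : I →ₗ[R] C ⊗[R] T} (hι : Function.Injective ι) :
    ∃ (s : (C →ₗ[R] I) →ₗ[R] T) (r : T →ₗ[R] C →ₗ[R] I), r ∘ₗ s = LinearMap.id := by
  obtain ⟨ρ, hρ⟩ := Module.Injective.out ι hι LinearMap.id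
  let η := LinearEquiv.ofBijective _ (hT.mk_flip_bijective hC)
  refine ⟨η.symm.toLinearMap ∘ₗ LinearMap.llcomp R C _ _ ι,
    LinearMap.llcomp R C _ _ ρ ∘ₗ η.toLinearMap, ?_⟩
  ext v c
  exact (congrArg ρ (LinearMap.congr_fun (η.apply_symm_apply (ι ∘ₗ v)) c)).trans (hρ _)

theorem IsGCHereditary.torOneVanishes_hom (hC : IsSemidualizing R C) (hR : IsGCHereditary R C)
    {I Y : Type u} [AddCommGroup I] [Module R I] [Module.Injective R I] [AddCommGroup Y]
    [Module R Y] (hY : EmbedsInFlatOrCFlat R C Y) : TorOneVanishes R Y (C →ₗ[R] I) := by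
  obtain ⟨T, W, ι, δ, hT, -, hι, -⟩ := hR.exists_embedding hC I
  obtain ⟨s, r, hrs⟩ := hT.exists_hom_retract hC hι
  exact (hT.torOneVanishes hC hY).of_retract s r hrs

theorem TwoSidedSeq.IsExact.isTensorExact (hC : IsSemidualizing R C) (hR : IsGCHereditary R C)
    {X : TwoSidedSeq R} (hX : X.IsExact) (hL : ∀ n, Module.Flat R (X.L n))
    (hK : ∀ n, IsCFlat R C (X.K n)) (I : Type u) [AddCommGroup I] [Module R I]
    [Module.Injective R I] : X.IsTensorExact (C →ₗ[R] I) := by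
  have hrangeK : ∀ {Y : Type u} [AddCommGroup Y] [Module R Y] (n) (f : Y →ₗ[R] X.K n),
      TorOneVanishes R (LinearMap.range f) (C →ₗ[R] I) := fun n f =>
    hR.torOneVanishes_hom hC ((hK n).embedsInFlatOrCFlat_range f)
  have hrangeL : ∀ n, TorOneVanishes R (LinearMap.range (X.dL n)) (C →ₗ[R] I) := fun n =>
    hR.torOneVanishes_hom hC (.of_flat (Submodule.injective_subtype _))
  constructor
  · rintro (_ | n)
    · exact lTensor_exact_of_torOneVanishes (hX.left 0) hX.midLeft (hrangeK 0 _)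
    · exact lTensor_exact_of_torOneVanishes (hX.left (n + 1)) (hX.left n) (hrangeL n)
  · exact lTensor_exact_of_torOneVanishes hX.midLeft hX.midRight (hrangeK 1 _)
  · exact lTensor_exact_of_torOneVanishes hX.midRight (hX.right 0) (hrangeK 2 _)
  · exact fun n => lTensor_exact_of_torOneVanishes (hX.right n) (hX.right (n + 1)) (hrangeK _ _)

theorem HasCMonicPresentation.torOneVanishes_of_tensorProduct {T T' X : Type u} [AddCommGroup T]
    [Module R T] [AddCommGroup T'] [Module R T'] [AddCommGroup X] [Module R X]
    (hT : HasCMonicPresentation R C T) (h : TorOneVanishes R (C ⊗[R] T) T')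
    {ι : X →ₗ[R] C ⊗[R] T'} (hι : Function.Injective ι) : TorOneVanishes R X T := by
  obtain ⟨P, Q, f, g, _, _, hfg, hg, hf⟩ := hT
  have hCf : Function.Injective ((f.lTensor C).lTensor T') :=
    h.lTensor_injective hf (lTensor_exact C hfg hg) (LinearMap.lTensor_surjective C hg)
  refine .of_presentation hfg hg (lTensor_injective_of_injective
    (k := (TensorProduct.comm R C T').toLinearMap ∘ₗ ι)
    ((TensorProduct.comm R C T').injective.comp hι)
    (lTensor_tensorProduct_injective_iff.2 hCf))

theorem IsGCHereditary.flat_of_exact (hC : IsSemidualizing R C) (hR : IsGCHereditary R C)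
    {N T W : Type u} [AddCommGroup N] [Module R N] [AddCommGroup T] [Module R T]
    [AddCommGroup W] [Module R W] (hN : EmbedsInFlatOrCFlat R C N)
    (hT : HasCMonicPresentation R C T) (hW : IsCFlat R C W) {ι : N →ₗ[R] C ⊗[R] T}
    {δ : C ⊗[R] T →ₗ[R] W} (hι : Function.Injective ι) (hιδ : Function.Exact ι δ) :
    Module.Flat R T := by
  refine flat_of_forall_torOneVanishes fun X _ _ => ?_
  obtain ⟨T', W', ι', δ', hT', -, hι', -⟩ := hR.exists_embedding hC X
  exact hT.torOneVanishes_of_tensorProduct (.of_extension hι (exact_rangeRestrict hιδ)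
    δ.surjective_rangeRestrict (hT'.torOneVanishes hC hN)
    (hT'.torOneVanishes hC (hW.embedsInFlatOrCFlat_range δ))) hι'

theorem IsGCHereditary.exists_isCFlat_embedding (hC : IsSemidualizing R C)
    (hR : IsGCHereditary R C) {N : Type u} [AddCommGroup N] [Module R N]
    (hN : EmbedsInFlatOrCFlat R C N) :
    ∃ (K N' : ModuleCat.{u} R) (ι : N →ₗ[R] K) (π : K →ₗ[R] N'), IsCFlat R C K ∧
      EmbedsInFlatOrCFlat R C N' ∧ Function.Injective ι ∧ Function.Exact ι π ∧
      Function.Surjective π := by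
  obtain ⟨T, W, ι, δ, hT, hW, hι, hιδ⟩ := hR.exists_embedding hC N
  exact ⟨ModuleCat.of R (C ⊗[R] T), ModuleCat.of R (LinearMap.range δ), ι, δ.rangeRestrict,
    ⟨T, hR.flat_of_exact hC hN hT hW.isCFlat hι hιδ, ⟨LinearEquiv.refl R _⟩⟩,
    hW.isCFlat.embedsInFlatOrCFlat_range δ, hι, exact_rangeRestrict hιδ,
    δ.surjective_rangeRestrict⟩

end Flatness

theorem exists_projective_resolution (R : Type u) [CommRing R] (M : Type u) [AddCommGroup M]
    [Module R M] : ∃ (L : ℕ → ModuleCat.{u} R) (d : ∀ n, L (n + 1) →ₗ[R] L n) (ε : L 0 →ₗ[R] M),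
      (∀ n, Module.Projective R (L n)) ∧ Function.Surjective ε ∧ Function.Exact (d 0) ε ∧
      ∀ n, Function.Exact (d (n + 1)) (d n) := by
  choose A B i p hB hi hip hp using
    fun X : ModuleCat.{u} R => exists_projective_presentation R X
  have hexact : ∀ X : ModuleCat.{u} R, Function.Exact (i X ∘ₗ p (A X)) (p X) := fun X =>
    (hp (A X)).comp_exact_iff_exact.2 (hip X)
  let Z : ℕ → ModuleCat.{u} R := fun n => Nat.rec (ModuleCat.of R M) (fun _ X => A X) n
  exact ⟨fun n => B (Z n), fun n => i (Z n) ∘ₗ p (Z (n + 1)), p (Z 0), fun n => hB _, hp _,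
    hexact _, fun n => (hi (Z n)).comp_exact_iff_exact.2 (hexact (Z (n + 1)))⟩

theorem exists_coresolution {𝒩 𝒦 : ModuleCat.{u} R → Prop}
    (h : ∀ N, 𝒩 N → ∃ (K N' : ModuleCat.{u} R) (ι : N →ₗ[R] K) (π : K →ₗ[R] N'), 𝒦 K ∧ 𝒩 N' ∧
      Function.Injective ι ∧ Function.Exact ι π ∧ Function.Surjective π)
    {M : ModuleCat.{u} R} (hM : 𝒩 M) :
    ∃ (K : ℕ → ModuleCat.{u} R) (d : ∀ n, K n →ₗ[R] K (n + 1)) (ι : M →ₗ[R] K 0),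
      (∀ n, 𝒦 (K n)) ∧ Function.Injective ι ∧ Function.Exact ι (d 0) ∧
      ∀ n, Function.Exact (d n) (d (n + 1)) := by
  choose K N ι π hK hN hι hιπ hπ using h
  let Z : ℕ → {X : ModuleCat.{u} R // 𝒩 X} := fun n =>
    Nat.rec ⟨M, hM⟩ (fun _ X => ⟨N X.1 X.2, hN X.1 X.2⟩) n
  have hexact : ∀ n, Function.Exact (ι _ (Z n).2) (ι _ (Z (n + 1)).2 ∘ₗ π _ (Z n).2) := fun n =>
    (hι _ (Z (n + 1)).2).comp_exact_iff_exact.2 (hιπ _ (Z n).2)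
  exact ⟨fun n => K _ (Z n).2, fun n => ι _ (Z (n + 1)).2 ∘ₗ π _ (Z n).2, ι M hM,
    fun n => hK _ _, hι _ _, hexact 0, fun n =>
      (hπ _ (Z n).2).comp_exact_iff_exact.2 (hexact (n + 1))⟩

theorem IsGCHereditary.isGCFlat {C : Type u} [AddCommGroup C] [Module R C]
    (hC : IsSemidualizing R C) (hR : IsGCHereditary R C) {N : Type u} [AddCommGroup N]
    [Module R N] (hN : EmbedsInFlatOrCFlat R C N) : IsGCFlat R C N := by
  obtain ⟨L, dL, ε, hL, hε, hdLε, hdL⟩ := exists_projective_resolution R N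
  obtain ⟨K, dK, ι, hK, hι, hιdK, hdK⟩ := exists_coresolution
    (𝒩 := fun N => EmbedsInFlatOrCFlat R C N) (𝒦 := fun K => IsCFlat R C K)
    (fun N hN => hR.exists_isCFlat_embedding hC hN) (M := ModuleCat.of R N) hN
  let X : TwoSidedSeq R := ⟨L, K, dL, ι ∘ₗ ε, dK⟩
  have hX : X.IsExact :=
    ⟨hdL, hι.comp_exact_iff_exact.2 hdLε, hε.comp_exact_iff_exact.2 hιdK, hdK⟩
  have hflat : ∀ n, Module.Flat R (L n) := fun n => inferInstance
  have hrange : LinearMap.range ι = LinearMap.range X.mid :=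
    (LinearMap.range_comp_of_range_eq_top _ (LinearMap.range_eq_top.2 hε)).symm
  exact ⟨X, hflat, hK, hX, ⟨(LinearEquiv.ofInjective ι hι).trans (LinearEquiv.ofEq _ _ hrange)⟩,
    fun I _ _ _ => hX.isTensorExact hC hR hflat hK I⟩

section PowersEmbed

variable {J : Type u} {M M' : Type*} [AddCommGroup M] [Module R M] [AddCommGroup M'] [Module R M']

/-- The canonical map `M ⊗ R^J → M^J` is injective. By Chase's criterion a finitely generated
module with this property for all `J` is finitely presented. -/
def PowersEmbed (R : Type u) [CommRing R] (J : Type u) (M : Type*) [AddCommGroup M]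
    [Module R M] : Prop :=
  Function.Injective (TensorProduct.piScalarRightHom R R M J)

theorem piScalarRightHom_rTensor (f : M →ₗ[R] M') (x : M ⊗[R] (J → R)) :
    TensorProduct.piScalarRightHom R R M' J (f.rTensor (J → R) x) =
      fun j => f (TensorProduct.piScalarRightHom R R M J x j) := by
  induction x with
  | zero => ext; simp
  | tmul m r => ext; simp
  | add x y hx hy => ext j; simp [hx, hy]

theorem piScalarRightHom_pi_fin_surjective (J : Type u) (n : ℕ) :
    Function.Surjective (TensorProduct.piScalarRightHom R R (Fin n → R) J) := by
  intro z
  refine ⟨∑ k, Pi.single k 1 ⊗ₜ[R] (fun j => z j k), ?_⟩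
  ext j l
  simp [Finset.sum_apply, Pi.single_apply]

namespace PowersEmbed

theorem of_rTensor_injective {f : M →ₗ[R] M'} (h : PowersEmbed R J M')
    (hf : Function.Injective (f.rTensor (J → R))) : PowersEmbed R J M := by
  refine (injective_iff_map_eq_zero _).2 fun x hx => hf (h ?_)
  rw [piScalarRightHom_rTensor, hx, map_zero, map_zero]
  exact funext fun _ => map_zero f

theorem of_retract (h : PowersEmbed R J M) (s : M' →ₗ[R] M) (r : M →ₗ[R] M')
    (hrs : r ∘ₗ s = LinearMap.id) : PowersEmbed R J M' :=
  h.of_rTensor_injective <| Function.LeftInverse.injective (g := r.rTensor (J → R)) fun x => by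
    rw [← LinearMap.rTensor_comp_apply, hrs, LinearMap.rTensor_id_apply]

theorem finsupp {ι : Type*} (h : PowersEmbed R J M) : PowersEmbed R J (ι →₀ M) := by
  classical
  refine (injective_iff_map_eq_zero _).2 fun x hx => ?_
  apply (TensorProduct.finsuppLeft R R M (J → R) ι).injective
  rw [map_zero]
  ext1 k
  rw [TensorProduct.finsuppLeft_apply]
  apply h
  rw [piScalarRightHom_rTensor, hx]
  ext j
  simp

theorem self (J : Type u) : PowersEmbed R J R := by
  have hlid : TensorProduct.piScalarRightHom R R R J =
      (TensorProduct.lid R (J → R)).toLinearMap := by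
    ext r j
    simp [mul_comm]
  rw [PowersEmbed, hlid]
  exact (TensorProduct.lid R (J → R)).injective

theorem pi_fin (J : Type u) (n : ℕ) : PowersEmbed R J (Fin n → R) :=
  ((self J).finsupp (ι := Fin n)).of_retract
    (Finsupp.linearEquivFunOnFinite R R (Fin n)).symm.toLinearMap
    (Finsupp.linearEquivFunOnFinite R R (Fin n)).toLinearMap (by ext; simp)

theorem of_finitePresentation (J : Type u) (M : Type*) [AddCommGroup M] [Module R M]
    [Module.FinitePresentation R M] : PowersEmbed R J M := by
  obtain ⟨n, m, f, g, hf, hgf⟩ := Module.FinitePresentation.exists_fin' R M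
  refine (injective_iff_map_eq_zero _).2 fun x hx => ?_
  obtain ⟨y, rfl⟩ := LinearMap.rTensor_surjective (J → R) hf x
  rw [piScalarRightHom_rTensor] at hx
  choose z hz using fun j => (hgf _).1 (congrFun hx j)
  obtain ⟨w, rfl⟩ := piScalarRightHom_pi_fin_surjective (R := R) J m z
  have hw : g.rTensor (J → R) w = y := pi_fin J n (by
    rw [piScalarRightHom_rTensor]
    exact funext hz)
  exact (rTensor_exact (J → R) hgf hf _).2 ⟨w, hw⟩

end PowersEmbed

theorem finitePresentation_of_forall_powersEmbed [Module.Finite R M]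
    (h : ∀ J : Type u, PowersEmbed R J M) : Module.FinitePresentation R M := by
  obtain ⟨n, f, hf⟩ := Module.Finite.exists_fin' R M
  refine Module.finitePresentation_of_surjective f hf ?_
  let Z := LinearMap.ker f
  -- The inclusion of `Z`, viewed as a `Z`-indexed family, comes from a finite sum of tensors in
  -- `Z ⊗ R^Z`; their first components then generate `Z`.
  obtain ⟨y, hy⟩ := piScalarRightHom_pi_fin_surjective (R := R) Z n Subtype.val
  have hfy : f.rTensor (Z → R) y = 0 := h Z (by
    rw [piScalarRightHom_rTensor, hy, map_zero]
    exact funext fun z => z.2)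
  obtain ⟨w, rfl⟩ := (rTensor_exact (Z → R) f.exact_subtype_ker_map hf y).1 hfy
  have hw : ∀ z : Z, TensorProduct.piScalarRightHom R R Z Z w z = z := fun z =>
    Subtype.ext ((congrFun ((piScalarRightHom_rTensor Z.subtype w).symm.trans hy) z))
  obtain ⟨t, rfl⟩ := TensorProduct.exists_finset w
  classical
  refine Module.Finite.iff_fg.1 ⟨t.image Prod.fst, eq_top_iff.2 fun z _ => ?_⟩
  rw [← hw z, map_sum, Finset.sum_apply]
  refine Submodule.sum_mem _ fun a ha => ?_
  rw [TensorProduct.piScalarRightHom_tmul]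
  exact Submodule.smul_mem _ _ (Submodule.subset_span (Finset.mem_image_of_mem _ ha))

end PowersEmbed

theorem exists_injective_embedding (R : Type u) [CommRing R] (M : Type u) [AddCommGroup M]
    [Module R M] : ∃ (E : ModuleCat.{u} R) (κ : M →ₗ[R] E), Module.Injective R E ∧
      Function.Injective κ :=
  ⟨CategoryTheory.Injective.under (ModuleCat.of R M),
    (CategoryTheory.Injective.ι (ModuleCat.of R M)).hom,
    (Module.injective_iff_injective_object R _).2
      (CategoryTheory.Injective.injective_under (ModuleCat.of R M)),
    (ModuleCat.mono_iff_injective _).1 inferInstance⟩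

section Coherence

variable {C J E E' : Type u} [AddCommGroup C] [Module R C] [AddCommGroup E] [Module R E]
  [AddCommGroup E'] [Module R E'] {κ : (J → C) →ₗ[R] E} {p : E →ₗ[R] E'}

theorem IsGCHereditary.injective_of_exact [Module.Injective R E] (hR : IsGCHereditary R C)
    (hκ : Function.Injective κ) (hκp : Function.Exact κ p) (hp : Function.Surjective p) :
    Module.Injective R E' := by
  refine Module.Baer.injective fun I φ => ?_
  obtain ⟨L, q, hL, hq, hext⟩ := (hR R inferInstance I).exists_presentation
  obtain ⟨v, hv⟩ := ExtendsAlong.exists_lift hq (hext.pi J) hκ hκp hp φ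
  obtain ⟨w, hw⟩ := Module.Injective.out I.subtype I.injective_subtype v
  exact ⟨p ∘ₗ w, fun x hx => (congrArg p (hw ⟨x, hx⟩)).trans (LinearMap.congr_fun hv _)⟩

/-- The map `R^J → Hom(C, C^J)` sending `r` to `c ↦ (j ↦ r j • c)`, which is an isomorphism for
semidualizing `C`. -/
def piHomothety (R C J : Type u) [CommRing R] [AddCommGroup C] [Module R C] :
    (J → R) →ₗ[R] C →ₗ[R] J → C :=
  LinearMap.mk₂ R (fun r c j => r j • c)
    (fun r r' c => by ext; simp [add_smul]) (fun a r c => by ext; simp [mul_smul])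
    (fun r c c' => by ext; simp) (fun a r c => by ext j; exact smul_comm (r j) a c)

theorem piHomothety_bijective (hC : Function.Bijective (LinearMap.lsmul R C)) (J : Type u) :
    Function.Bijective (piHomothety R C J) := by
  refine ⟨fun r r' h => funext fun j => hC.1 (LinearMap.ext fun c =>
    congrFun (LinearMap.congr_fun h c) j), fun u => ?_⟩
  choose r hr using fun j => hC.2 (LinearMap.proj j ∘ₗ u)
  exact ⟨r, LinearMap.ext fun c => funext fun j => LinearMap.congr_fun (hr j) c⟩

theorem IsSemidualizing.exists_pi_embedding (hC : IsSemidualizing R C)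
    (hκ : Function.Injective κ) (hκp : Function.Exact κ p) (hp : Function.Surjective p) :
    ∃ (μ : (J → R) →ₗ[R] C →ₗ[R] E) (pC : (C →ₗ[R] E) →ₗ[R] C →ₗ[R] E'),
      Function.Injective μ ∧ Function.Exact μ pC ∧ Function.Surjective pC := by
  have hbij := piHomothety_bijective hC.homothety J
  let κC : (C →ₗ[R] J → C) →ₗ[R] C →ₗ[R] E := LinearMap.llcomp R C (J → C) E κ
  have hκC : Function.Injective κC := fun _ _ h => (LinearMap.cancel_left hκ).1 h
  refine ⟨κC ∘ₗ piHomothety R C J, LinearMap.llcomp R C E E' p, hκC.comp hbij.1,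
    hbij.2.comp_exact_iff_exact.2 fun v => ⟨fun hv => ?_, ?_⟩, fun v => ?_⟩
  · have hrange : ∀ c, v c ∈ LinearMap.range κ := fun c =>
      (hκp _).1 (LinearMap.congr_fun hv c)
    exact ⟨v.codRestrictOfInjective κ hκ hrange,
      LinearMap.ext (v.codRestrictOfInjective_comp_apply κ hκ hrange)⟩
  · rintro ⟨u, rfl⟩
    exact LinearMap.ext fun c => hκp.apply_apply_eq_zero _
  · obtain ⟨B, e, hB, -, he, -, hext⟩ := hC.exists_presentation
    exact ExtendsAlong.exists_lift he (hext.pi J) hκ hκp hp v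

theorem IsGCHereditary.torOneVanishes_pi (hC : IsSemidualizing R C) (hR : IsGCHereditary R C)
    {Y : Type u} [AddCommGroup Y] [Module R Y] (hY : EmbedsInFlatOrCFlat R C Y) (J : Type u) :
    TorOneVanishes R Y (J → R) := by
  obtain ⟨E, κ, hE, hκ⟩ := exists_injective_embedding R (J → C)
  have hp := (LinearMap.range κ).mkQ_surjective
  have hκp := κ.exact_map_mkQ_range
  have hE' : Module.Injective R (E ⧸ LinearMap.range κ) := hR.injective_of_exact hκ hκp hp
  obtain ⟨μ, pC, hμ, hμp, hpC⟩ := hC.exists_pi_embedding hκ hκp hp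
  obtain ⟨A, B, i, q, hB, hi, hiq, hq⟩ := exists_projective_presentation R Y
  have hμA : Function.Injective (μ.lTensor A) :=
    (hR.torOneVanishes_hom hC (.of_flat hi)).symm.lTensor_injective hμ hμp hpC
  have hiE : Function.Injective (i.rTensor (C →ₗ[R] E)) :=
    hR.torOneVanishes_hom hC hY A B i q hi hiq hq
  have hcomp : μ.lTensor B ∘ₗ i.rTensor (J → R) = i.rTensor (C →ₗ[R] E) ∘ₗ μ.lTensor A := by
    rw [LinearMap.rTensor_comp_lTensor, LinearMap.lTensor_comp_rTensor]
  have hinj : Function.Injective (μ.lTensor B ∘ i.rTensor (J → R)) := by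
    rw [← LinearMap.coe_comp, hcomp]
    exact hiE.comp hμA
  exact (TorOneVanishes.of_presentation hiq hq
    ((i.lTensor_inj_iff_rTensor_inj _).2 hinj.of_comp)).symm

theorem IsCProjective.powersEmbed [Module.FinitePresentation R C] {K : Type u} [AddCommGroup K]
    [Module R K] (hK : IsCProjective R C K) (J : Type u) : PowersEmbed R J K := by
  obtain ⟨P, hP, ⟨e⟩⟩ := hK
  obtain ⟨s, r, hrs⟩ := exists_retract_finsupp (R := R) C P
  exact ((PowersEmbed.of_finitePresentation J C).finsupp.of_retract s r hrs).of_retract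
    e.toLinearMap e.symm.toLinearMap (by ext; simp)

theorem IsGCProjective.powersEmbed (hC : IsSemidualizing R C) (hR : IsGCHereditary R C)
    {M : Type u} [AddCommGroup M] [Module R M] (hM : IsGCProjective R C M) (J : Type u) :
    PowersEmbed R J M := by
  have := hC.finitePresentation
  obtain ⟨S⟩ := hM.nonempty_copresentation
  have hrange : EmbedsInFlatOrCFlat R C (LinearMap.range S.d₀) :=
    S.isCProjective₁.isCFlat.embedsInFlatOrCFlat_range _
  exact (S.isCProjective₀.powersEmbed J).of_rTensor_injective
    (hR.torOneVanishes_pi hC hrange J _ _ _ _ S.injective_a (exact_rangeRestrict S.exact_a_d₀)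
      S.d₀.surjective_rangeRestrict)

theorem IsGCHereditary.isCoherentRing (hC : IsSemidualizing R C) (hR : IsGCHereditary R C) :
    IsCoherentRing R := fun I hI => by
  have : Module.Finite R I := Module.Finite.iff_fg.2 hI
  exact finitePresentation_of_forall_powersEmbed ((hR R inferInstance I).powersEmbed hC hR)

end Coherence

theorem theorem3p8 (R : Type u) [CommRing R] (C : Type u) [AddCommGroup C] [Module R C]
    (hC : IsSemidualizing R C) (hR : IsGCHereditary R C) :
    IsGCSemihereditary R C :=
  ⟨hR.isCoherentRing hC, fun _ _ _ _ N =>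
    hR.isGCFlat hC (.of_flat N.injective_subtype)⟩
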